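/- Let $X$ be a real normed space and let $X^*$ be its topological dual. By an equivalent dual norm on $X^*$ we mean a norm on $X^*$ that is equivalent to the original norm and is the dual norm $f\mapsto\sup\{|f(x)| : x\in X,\ q(x)\le 1\}$ of some norm $q$ on $X$ equivalent to the original norm of $X$. The following are equivalent. (1) $X^*$ admits an equivalent dual norm $\|\cdot\|_A$ with the following property: for all sequences $(x_n^*)_{n\in\mathbb{N}},(y_n^*)_{n\in\mathbb{N}}\subseteq X^*$ and every $x^*\in X^*$, if $$\lim_{n\to\infty}\bigl(2\|x_n^*\|_A^2+2\|y_n^*\|_A^2-\|x_n^*+y_n^*\|_A^2\bigr)=0 \quad\text{and}\quad \lim_{n\to\infty}\bigl(2\|x^*\|_A^2+2\|x_n^*\|_A^2-\|x^*+x_n^*\|_A^2\bigr)=0,$$ then $y_n^*\to x^*$ in the weak$^*$ topology $\sigma(X^*,X)$. (2) $X^*$ admits an equivalent dual norm $\|\cdot\|_M$ such that the weak$^*$ topology restricted to its unit sphere $\{x^*\in X^* : \|x^*\|_M=1\}$ is metrizable. -/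

import Mathlib

open Filter Topology

/-- A seminorm `p` on a real normed space `E` is an equivalent norm: it is bounded above and
below by positive multiples of the given norm (in particular it is a norm). -/
def IsEquivalentNorm {E : Type*} [NormedAddCommGroup E] [NormedSpace ℝ E]
    (p : Seminorm ℝ E) : Prop :=
  ∃ c C : ℝ, 0 < c ∧ 0 < C ∧ ∀ x : E, c * ‖x‖ ≤ p x ∧ p x ≤ C * ‖x‖

/-- `p` is an equivalent dual norm on `X*`: it is an equivalent norm on `X*`, and it is the dual
norm `p f = sup {|f x| : q x ≤ 1}` of some equivalent norm `q` on `X`. -/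
def IsEquivalentDualNorm {X : Type*} [NormedAddCommGroup X] [NormedSpace ℝ X]
    (p : Seminorm ℝ (StrongDual ℝ X)) : Prop :=
  IsEquivalentNorm p ∧
    ∃ q : Seminorm ℝ X, IsEquivalentNorm q ∧
      ∀ f : StrongDual ℝ X, IsLUB ((fun x : X => |f x|) '' {x : X | q x ≤ 1}) (p f)

/-- The unit sphere of a (semi)norm `p` on `X*`, as a subset of `X*` with the weak* topology. -/
def weakStarUnitSphere {X : Type*} [NormedAddCommGroup X] [NormedSpace ℝ X]
    (p : Seminorm ℝ (StrongDual ℝ X)) : Set (WeakDual ℝ X) :=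
  {f : WeakDual ℝ X | p (WeakDual.toStrongDual f) = 1}

/-! (1) ⇒ (2) holds with the same norm. On the unit sphere `ρ s r = 4 - p (s + r) ^ 2` is the
convexity defect, and its balls are weak* open because a dual norm is weak* lower semicontinuous.
The hypothesis, read on sequences, says that these balls are neighbourhood bases satisfying Frink's
condition.

(2) ⇒ (1): let `S` be the metrizable sphere of `p`, and view `X` inside the bounded continuous
functions on `S`. Each functional `f` lifts to positive functionals on this larger space, with mass
at least `p f` and with equality for a multiple of a point evaluation. Take partitions of unity on
`S` subordinate to balls of radius `1 / (k + 1)`. The norm `N_m f` is the least `ℓ²` norm, over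
positive lifts of `f`, of the values at `1` and at the members of the partitions weighted by `2^-m
2^-k`. By weak* compactness the minimum is attained and `N_m` is weak* lower semicontinuous. The
norm `A` is a weighted `ℓ²` sum of all `N_m (±f)`.

If the defects of `A` vanish, so do those of each `N_m`. By the parallelogram identity, optimal
lifts of `y n` then converge to the optimal lift of `a` at `1` and at every partition function
(`quotientNorm_defect`). This suffices to recover `a v`: as `m` grows, optimal lifts of `a` cluster
at a lift of minimal mass, and such a lift is tight (`exists_isCompact_tight`). So for some `m` the
optimal lift of `a` nearly lives on finitely many partition functions on which `v` is almost
constant (`exists_tight_optimal_lift`). -/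

open scoped BoundedContinuousFunction

/-! ### Metrization from neighbourhood bases. -/

/-- Frink's metrization theorem. -/
theorem metrizableSpace_of_frink {T : Type*} [TopologicalSpace T] [T0Space T]
    (V : ℕ → T → Set T) (anti : ∀ x, Antitone fun n => V n x)
    (basis : ∀ x, (𝓝 x).HasBasis (fun _ => True) fun n => V n x)
    (frink : ∀ x n, ∃ m, ∀ y, (V m x ∩ V m y).Nonempty → V m y ⊆ V n x) :
    TopologicalSpace.MetrizableSpace T := by
  choose m hm using frink
  have hm' : ∀ x n l, m x n ≤ l → ∀ y, (V l x ∩ V l y).Nonempty → V l y ⊆ V n x := by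
    intro x n l hl y hy
    exact (anti y hl).trans
      (hm x n y (hy.mono (Set.inter_subset_inter (anti x hl) (anti y hl))))
  have self : ∀ x n, x ∈ V n x := fun x n => mem_of_mem_nhds ((basis x).mem_of_mem trivial)
  -- Indices growing so fast that any `V (k x (n + 1)) y` meeting `V (k x (n + 1)) x` lies in `V (k
  -- x n) x`.
  let k : T → ℕ → ℕ := fun x n => Nat.rec 0 (fun n r => max (n + 1) (max (m x r) r)) n
  have k_succ : ∀ x n, k x (n + 1) = max (n + 1) (max (m x (k x n)) (k x n)) := fun _ _ => rfl
  have k_ge : ∀ x n, n ≤ k x n := by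
    intro x n
    cases n with
    | zero => exact Nat.zero_le _
    | succ n => rw [k_succ]; exact le_max_left _ _
  have k_mono : ∀ x, Monotone (k x) := fun x => monotone_nat_of_le_succ fun n => by
    rw [k_succ]; exact (le_max_right _ _).trans (le_max_right _ _)
  have k_m : ∀ x n, m x (k x n) ≤ k x (n + 1) := fun x n => by
    rw [k_succ]; exact (le_max_left _ _).trans (le_max_right _ _)
  let E : ℕ → Set (T × T) := fun n => {a | ∃ x i, n ≤ i ∧ a.1 ∈ V (k x i) x ∧ a.2 ∈ V (k x i) x}
  have E_anti : Antitone E := fun a b hab z ⟨x, i, hi, h⟩ => ⟨x, i, hab.trans hi, h⟩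
  -- Of two meeting sets, the one with the smaller index absorbs the other after one step back in
  -- `k`; this gives the composition axiom for `E`.
  have key : ∀ n x y i j, n + 1 ≤ i → n + 1 ≤ j → k x i ≤ k y j →
      (V (k x i) x ∩ V (k y j) y).Nonempty →
      ∃ l, n ≤ l ∧ V (k x i) x ⊆ V (k x l) x ∧ V (k y j) y ⊆ V (k x l) x := by
    intro n x y i j hi hj hle hne
    obtain ⟨l, rfl⟩ : ∃ l, i = l + 1 := ⟨i - 1, by omega⟩
    refine ⟨l, by omega, anti x (k_mono x (Nat.le_succ l)), ?_⟩
    exact (anti y hle).trans (hm' x _ _ (k_m x l) y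
      (hne.mono (Set.inter_subset_inter_right _ (anti y hle))))
  have hasB : (⨅ n, 𝓟 (E n)).HasBasis (fun _ => True) E :=
    hasBasis_iInf_principal (directed_of_isDirected_le E_anti)
  let u : UniformSpace.Core T := UniformSpace.Core.mk' (⨅ n, 𝓟 (E n))
    (by
      intro r hr x
      obtain ⟨n, -, hn⟩ := hasB.mem_iff.1 hr
      exact hn ⟨x, n, le_rfl, self _ _, self _ _⟩)
    (by
      intro r hr
      obtain ⟨n, -, hn⟩ := hasB.mem_iff.1 hr
      refine hasB.mem_iff.2 ⟨n, trivial, fun z hz => hn ?_⟩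
      obtain ⟨x, i, hi, h1, h2⟩ := hz
      exact ⟨x, i, hi, h2, h1⟩)
    (by
      intro r hr
      obtain ⟨n, -, hn⟩ := hasB.mem_iff.1 hr
      refine ⟨E (n + 1), hasB.mem_of_mem trivial, ?_⟩
      rintro ⟨a, c⟩ ⟨b, ⟨x, i, hi, ha, hb⟩, ⟨y, j, hj, hb', hc⟩⟩
      apply hn
      rcases le_total (k x i) (k y j) with h | h
      · obtain ⟨l, hl, h1, h2⟩ := key n x y i j hi hj h ⟨b, hb, hb'⟩
        exact ⟨x, l, hl, h1 ha, h2 hc⟩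
      · obtain ⟨l, hl, h1, h2⟩ := key n y x j i hj hi h ⟨b, hb', hb⟩
        exact ⟨y, l, hl, h2 ha, h1 hc⟩)
  have hu : u.uniformity = ⨅ n, 𝓟 (E n) := rfl
  have hnhds : ∀ x, 𝓝 x = comap (Prod.mk x) u.uniformity := by
    intro x
    rw [hu]
    refine (basis x).eq_of_same_basis ((hasB.comap (Prod.mk x)).to_hasBasis ?_ ?_)
    · rintro n -
      exact ⟨k x n, trivial, fun y hy => ⟨x, n, le_rfl, self _ _, hy⟩⟩
    · rintro l -
      refine ⟨m x l, trivial, ?_⟩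
      rintro y ⟨z, i, hi, hx, hy⟩
      have h1 : m x l ≤ k z i := hi.trans (k_ge z i)
      exact hm x l z ⟨x, self _ _, anti z h1 hx⟩ (anti z h1 hy)
  let us : UniformSpace T :=
    { __ := u
      toTopologicalSpace := inferInstance
      nhds_eq_comap_uniformity := hnhds }
  have : IsCountablyGenerated (uniformity T) := by
    change IsCountablyGenerated (⨅ n, 𝓟 (E n))
    infer_instance
  exact UniformSpace.metrizableSpace

/-! ### Dual norms as weak* closed balls, and the implication (1) ⇒ (2). -/

section Dual

variable {X : Type*} [NormedAddCommGroup X] [NormedSpace ℝ X]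

theorem IsEquivalentDualNorm.isClosed_sublevel {p : Seminorm ℝ (StrongDual ℝ X)}
    (hp : IsEquivalentDualNorm p) (c : ℝ) :
    IsClosed {f : WeakDual ℝ X | p (WeakDual.toStrongDual f) ≤ c} := by
  obtain ⟨-, q, -, hq⟩ := hp
  have : {f : WeakDual ℝ X | p (WeakDual.toStrongDual f) ≤ c} =
      ⋂ x ∈ {x : X | q x ≤ 1}, {f : WeakDual ℝ X | |f x| ≤ c} := by
    ext f
    simp only [Set.mem_ofPred_eq, Set.mem_iInter]
    rw [isLUB_le_iff (hq (WeakDual.toStrongDual f))]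
    simp [mem_upperBounds]
  rw [this]
  exact isClosed_biInter fun x _ =>
    isClosed_le (WeakDual.eval_continuous x).abs continuous_const

theorem IsEquivalentNorm.isCompact_sublevel {p : Seminorm ℝ (StrongDual ℝ X)}
    (hp : IsEquivalentNorm p) {c : ℝ}
    (hc : IsClosed {f : WeakDual ℝ X | p (WeakDual.toStrongDual f) ≤ c}) :
    IsCompact {f : WeakDual ℝ X | p (WeakDual.toStrongDual f) ≤ c} := by
  obtain ⟨a, b, ha, hb, h⟩ := hp
  refine (WeakDual.isCompact_closedBall (𝕜 := ℝ) (E := X) 0 (c / a)).of_isClosed_subset hc ?_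
  intro f hf
  have := (h (WeakDual.toStrongDual f)).1.trans hf
  simp only [Set.mem_preimage, Metric.mem_closedBall, dist_zero_right]
  rw [le_div_iff₀ ha, mul_comm]
  exact this

theorem WeakDual.exists_eval_eq (g : WeakDual ℝ X →L[ℝ] ℝ) : ∃ v : X, ∀ f, g f = f v := by
  obtain ⟨v, hv⟩ := LinearMap.dualEmbedding_surjective (topDualPairing ℝ X) g
  exact ⟨v, fun f => by rw [← hv]; rfl⟩

/-- An equivalent norm on the dual whose unit ball is weak* closed is a dual norm. -/
theorem IsEquivalentNorm.isEquivalentDualNorm {p : Seminorm ℝ (StrongDual ℝ X)}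
    (hp : IsEquivalentNorm p)
    (hc : IsClosed {f : WeakDual ℝ X | p (WeakDual.toStrongDual f) ≤ 1}) :
    IsEquivalentDualNorm p := by
  refine ⟨hp, ?_⟩
  obtain ⟨c, C, hc0, hC0, h⟩ := hp
  let B := {f : StrongDual ℝ X // p f ≤ 1}
  have : Nonempty B := ⟨⟨0, by simp⟩⟩
  have hB : ∀ (f : B) (v : X), |f.1 v| ≤ c⁻¹ * ‖v‖ := by
    intro f v
    refine (f.1.le_opNorm v).trans (mul_le_mul_of_nonneg_right ?_ (norm_nonneg v))
    rw [← one_div, le_div_iff₀ hc0, mul_comm]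
    exact (h f.1).1.trans f.2
  have bdd : ∀ v : X, BddAbove (Set.range fun f : B => |f.1 v|) := by
    rintro v
    refine ⟨c⁻¹ * ‖v‖, ?_⟩
    rintro _ ⟨f, rfl⟩
    exact hB f v
  -- The predual norm is the support function of the dual unit ball.
  let q : Seminorm ℝ X := Seminorm.of (fun v => ⨆ f : B, |f.1 v|)
    (by
      intro v w
      refine ciSup_le fun f => ?_
      rw [map_add]
      exact (abs_add_le _ _).trans (add_le_add (le_ciSup (bdd v) f) (le_ciSup (bdd w) f)))
    (by
      intro a v
      simp only [map_smul, smul_eq_mul, abs_mul, Real.norm_eq_abs]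
      rw [Real.mul_iSup_of_nonneg (abs_nonneg a)])
  have le_q : ∀ (f : B) (v : X), |f.1 v| ≤ q v := fun f v => le_ciSup (bdd v) f
  have q_le : ∀ (v : X) (r : ℝ), (∀ f : B, |f.1 v| ≤ r) → q v ≤ r := fun v r hr => ciSup_le hr
  have q_lower : ∀ v : X, C⁻¹ * ‖v‖ ≤ q v := by
    intro v
    obtain ⟨g, hg, hgv⟩ := exists_dual_vector'' ℝ v
    have hpg : p (C⁻¹ • g) ≤ 1 := by
      rw [map_smul_eq_mul, Real.norm_of_nonneg (inv_nonneg.2 hC0.le), inv_mul_le_iff₀ hC0]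
      exact (h g).2.trans (mul_le_mul_of_nonneg_left hg hC0.le)
    have := le_q ⟨_, hpg⟩ v
    simpa [hgv, abs_mul, abs_of_pos hC0] using this
  refine ⟨q, ⟨C⁻¹, c⁻¹, inv_pos.2 hC0, inv_pos.2 hc0, fun v =>
    ⟨q_lower v, q_le v _ fun f => hB f v⟩⟩, fun f => ⟨?_, ?_⟩⟩
  · rintro _ ⟨v, hv, rfl⟩
    rcases (apply_nonneg p f).eq_or_lt with h0 | h0
    · have hf : f = 0 := by
        have := (h f).1
        rw [← h0] at this
        have h3 : ‖f‖ ≤ 0 := by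
          by_contra h4
          push Not at h4
          nlinarith
        exact norm_le_zero_iff.1 h3
      simp [hf]
    · have hpf : p ((p f)⁻¹ • f) ≤ 1 := by
        rw [map_smul_eq_mul, Real.norm_of_nonneg (inv_nonneg.2 h0.le), inv_mul_cancel₀ h0.ne']
      have := (le_q ⟨_, hpf⟩ v).trans hv
      simp only [smul_apply, smul_eq_mul, abs_mul, abs_inv,
        abs_of_pos h0] at this
      rwa [inv_mul_le_iff₀ h0, mul_one] at this
  · intro b hb
    have hb0 : 0 ≤ b := hb ⟨0, by simp, by simp⟩
    by_contra hlt
    push Not at hlt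
    -- Bipolar argument: `r⁻¹ • f` lies outside the weak* closed ball, so a vector `v` of `X`
    -- separates it, and `v` normalised by `q` violates the bound `b`.
    obtain ⟨r, hbr, hrf⟩ := exists_between hlt
    have hr0 : 0 < r := hb0.trans_lt hbr
    have hconv : Convex ℝ {f : WeakDual ℝ X | p (WeakDual.toStrongDual f) ≤ 1} := by
      have := (p.convex_closedBall 0 1)
      intro x hx y hy s t hs ht hst
      have h1 := this (x := WeakDual.toStrongDual x) (by simpa [Seminorm.mem_closedBall] using hx)
        (y := WeakDual.toStrongDual y) (by simpa [Seminorm.mem_closedBall] using hy) hs ht hst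
      simpa [Seminorm.mem_closedBall] using h1
    have hnot : StrongDual.toWeakDual (r⁻¹ • f) ∉
        {f : WeakDual ℝ X | p (WeakDual.toStrongDual f) ≤ 1} := by
      intro hmem
      change p (r⁻¹ • f) ≤ 1 at hmem
      rw [map_smul_eq_mul, Real.norm_of_nonneg (inv_nonneg.2 hr0.le), inv_mul_le_iff₀ hr0] at hmem
      linarith
    have : LocallyConvexSpace ℝ (WeakDual ℝ X) :=
      inferInstanceAs (LocallyConvexSpace ℝ (WeakBilin (topDualPairing ℝ X)))
    obtain ⟨g, u, hgu, hug⟩ := geometric_hahn_banach_closed_point hconv hc hnot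
    obtain ⟨v, hv⟩ := WeakDual.exists_eval_eq g
    have hqu : q v ≤ u := by
      refine q_le v u fun k => abs_le.2 ⟨?_, ?_⟩
      · have := hgu (StrongDual.toWeakDual (-k.1)) (by
          change p (-k.1) ≤ 1
          rw [map_neg_eq_map]; exact k.2)
        rw [hv] at this
        have h2 : -(k.1 v) < u := this
        linarith
      · have := hgu (StrongDual.toWeakDual k.1) k.2
        rw [hv] at this
        exact this.le
    rw [hv] at hug
    have hug' : u < r⁻¹ * f v := hug
    rcases (apply_nonneg q v).eq_or_lt with h0 | h0
    · have hv0 : v = 0 := by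
        have := q_lower v
        rw [← h0] at this
        have h3 : ‖v‖ ≤ 0 := by
          by_contra h4
          push Not at h4
          have := mul_pos (inv_pos.2 hC0) h4
          linarith
        exact norm_le_zero_iff.1 h3
      rw [hv0, map_zero, mul_zero] at hug'
      linarith
    · have hw : q ((q v)⁻¹ • v) ≤ 1 := by
        rw [map_smul_eq_mul, Real.norm_of_nonneg (inv_nonneg.2 h0.le), inv_mul_cancel₀ h0.ne']
      have h1 := hb ⟨_, hw, rfl⟩
      simp only [map_smul, smul_eq_mul] at h1
      have h2 := (le_abs_self _).trans h1
      rw [inv_mul_le_iff₀ h0] at h2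
      have h3 : u * r < f v := by
        rw [inv_mul_eq_div, lt_div_iff₀ hr0] at hug'
        exact hug'
      nlinarith

/-- The balls of the defect `ρ` serve as Frink neighbourhoods, although `ρ` need not satisfy a
triangle inequality; sequential limits under `H` replace it. -/
theorem metrizableSpace_weakStarUnitSphere {p : Seminorm ℝ (StrongDual ℝ X)}
    (hp : IsEquivalentDualNorm p)
    (H : ∀ (x y : ℕ → StrongDual ℝ X) (a : StrongDual ℝ X),
        Tendsto (fun n => 2 * p (x n) ^ 2 + 2 * p (y n) ^ 2 - p (x n + y n) ^ 2) atTop (𝓝 0) →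
        Tendsto (fun n => 2 * p a ^ 2 + 2 * p (x n) ^ 2 - p (a + x n) ^ 2) atTop (𝓝 0) →
        Tendsto (fun n => StrongDual.toWeakDual (y n)) atTop (𝓝 (StrongDual.toWeakDual a))) :
    TopologicalSpace.MetrizableSpace (weakStarUnitSphere p) := by
  let d : weakStarUnitSphere p → StrongDual ℝ X := fun s => WeakDual.toStrongDual s.1
  have pd : ∀ s, p (d s) = 1 := fun s => s.2
  let ρ : weakStarUnitSphere p → weakStarUnitSphere p → ℝ := fun s r => 4 - p (d s + d r) ^ 2
  have ρ_symm : ∀ s r, ρ s r = ρ r s := fun s r => by simp only [ρ, add_comm]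
  have ρ_self : ∀ s, ρ s s = 0 := fun s => by
    simp only [ρ, ← two_smul ℝ (d s), map_smul_eq_mul, pd]
    norm_num
  have ρ_nonneg : ∀ s r, 0 ≤ ρ s r := fun s r => by
    have h1 := map_add_le_add p (d s) (d r)
    rw [pd, pd] at h1
    have h2 := apply_nonneg p (d s + d r)
    simp only [ρ]
    nlinarith
  have lim : ∀ (x y : ℕ → weakStarUnitSphere p) (a : weakStarUnitSphere p),
      Tendsto (fun n => ρ (x n) (y n)) atTop (𝓝 0) → Tendsto (fun n => ρ a (x n)) atTop (𝓝 0) →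
      Tendsto y atTop (𝓝 a) := by
    intro x y a h1 h2
    refine tendsto_subtype_rng.2 (H (fun n => d (x n)) (fun n => d (y n)) (d a) ?_ ?_)
    · refine h1.congr fun n => ?_
      simp only [pd, ρ]
      ring
    · refine h2.congr fun n => ?_
      simp only [pd, ρ]
      ring
  have inv_lim : Tendsto (fun n : ℕ => 1 / ((n : ℝ) + 1)) atTop (𝓝 0) :=
    tendsto_one_div_add_atTop_nhds_zero_nat
  have small : ∀ x y : ℕ → weakStarUnitSphere p, (∀ n, ρ (x n) (y n) < 1 / ((n : ℝ) + 1)) →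
      Tendsto (fun n => ρ (x n) (y n)) atTop (𝓝 0) := fun x y h =>
    tendsto_of_tendsto_of_tendsto_of_le_of_le tendsto_const_nhds inv_lim
      (fun n => ρ_nonneg _ _) (fun n => (h n).le)
  let V : ℕ → weakStarUnitSphere p → Set (weakStarUnitSphere p) :=
    fun n s => {r | ρ s r < 1 / ((n : ℝ) + 1)}
  have V_open : ∀ n s, IsOpen (V n s) := by
    intro n s
    have h4 : (0 : ℝ) ≤ 4 - 1 / ((n : ℝ) + 1) := by
      have : 1 / ((n : ℝ) + 1) ≤ 1 := by
        rw [div_le_one (by positivity)]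
        linarith [n.cast_nonneg (α := ℝ)]
      linarith
    have : V n s = (fun r : weakStarUnitSphere p => s.1 + r.1) ⁻¹'
        {f : WeakDual ℝ X | p (WeakDual.toStrongDual f) ≤ √(4 - 1 / ((n : ℝ) + 1))}ᶜ := by
      ext r
      change 4 - p (d s + d r) ^ 2 < _ ↔ ¬ (p (d s + d r) ≤ _)
      rw [not_le, Real.sqrt_lt h4 (apply_nonneg _ _)]
      constructor <;> intro h <;> linarith
    rw [this]
    exact (hp.isClosed_sublevel _).isOpen_compl.preimage
      (continuous_const.add continuous_subtype_val)
  have V_self : ∀ n s, s ∈ V n s := fun n s => by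
    change ρ s s < _
    rw [ρ_self]; positivity
  have V_lim : ∀ (x : ℕ → weakStarUnitSphere p) (a : weakStarUnitSphere p),
      Tendsto x atTop (𝓝 a) → Tendsto (fun n => ρ a (x n)) atTop (𝓝 0) := by
    intro x a h
    rw [Metric.tendsto_atTop]
    intro ε hε
    obtain ⟨k, hk⟩ := exists_nat_one_div_lt hε
    obtain ⟨N, hN⟩ := eventually_atTop.1 (h.eventually ((V_open k a).mem_nhds (V_self k a)))
    refine ⟨N, fun n hn => ?_⟩
    rw [Real.dist_eq, sub_zero, abs_of_nonneg (ρ_nonneg _ _)]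
    exact (show ρ a (x n) < 1 / ((k : ℝ) + 1) from hN n hn).trans hk
  refine metrizableSpace_of_frink V ?_ ?_ ?_
  · intro s m n hmn r hr
    have hr' : ρ s r < 1 / ((n : ℝ) + 1) := hr
    exact (hr'.trans_le (Nat.one_div_le_one_div hmn) : ρ s r < 1 / ((m : ℝ) + 1))
  · refine fun a => ⟨fun U => ⟨fun hU => ?_, fun ⟨n, _, hn⟩ =>
      mem_of_superset ((V_open n a).mem_nhds (V_self n a)) hn⟩⟩
    by_contra! hcon
    choose x hx hxU using fun n => Set.not_subset.1 (hcon n trivial)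
    have h1 := lim x x a (by simp only [ρ_self]; exact tendsto_const_nhds)
      (small (fun _ => a) x hx)
    obtain ⟨N, hN⟩ := eventually_atTop.1 (h1.eventually hU)
    exact hxU N (hN N le_rfl)
  · intro a n
    by_contra! hcon
    choose y hz hw using hcon
    choose z hz using hz
    choose w hw hwn using fun m => Set.not_subset.1 (hw m)
    -- A failure of Frink's condition gives `z m` close to both `a` and `y m`, and `w m` close to `y
    -- m` but outside `V n a`. One use of `H` gives `y → a`, a second gives `w → a`.
    have hy := V_lim _ _ (lim z y a
      (small z y fun m => by rw [ρ_symm]; exact (hz m).2) (small (fun _ => a) z fun m => (hz m).1))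
    have hwa := lim y w a (small y w hw) hy
    obtain ⟨N, hN⟩ := eventually_atTop.1
      (hwa.eventually ((V_open n a).mem_nhds (V_self n a)))
    exact hwn N (hN N le_rfl)

end Dual

/-! ### The `ℓ²` norm and its convexity defect. -/

/-- The `ℓ²` norm of a real family. -/
noncomputable def l2 {J : Type*} (f : J → ℝ) : ℝ := √(∑' j, f j ^ 2)

section L2

variable {J : Type*} {f g : J → ℝ}

theorem l2_nonneg (f : J → ℝ) : 0 ≤ l2 f := Real.sqrt_nonneg _

theorem l2_sq (f : J → ℝ) : l2 f ^ 2 = ∑' j, f j ^ 2 :=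
  Real.sq_sqrt (tsum_nonneg fun _ => sq_nonneg _)

theorem summable_add_sq (sf : Summable fun j => f j ^ 2) (sg : Summable fun j => g j ^ 2) :
    Summable fun j => (f j + g j) ^ 2 :=
  .of_nonneg_of_le (fun _ => sq_nonneg _)
    (fun j => (by nlinarith [sq_nonneg (f j - g j)] :
      (f j + g j) ^ 2 ≤ 2 * f j ^ 2 + 2 * g j ^ 2))
    ((sf.mul_left 2).add (sg.mul_left 2))

theorem l2_add_le (hf : ∀ j, 0 ≤ f j) (hg : ∀ j, 0 ≤ g j) (sf : Summable fun j => f j ^ 2)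
    (sg : Summable fun j => g j ^ 2) : l2 (fun j => f j + g j) ≤ l2 f + l2 g := by
  have := (Real.Lp_add_le_tsum_of_nonneg (p := 2) (by norm_num) hf hg
    (by simpa using sf) (by simpa using sg)).2
  simpa [l2, Real.sqrt_eq_rpow] using this

theorem l2_mul_left {c : ℝ} (hc : 0 ≤ c) (f : J → ℝ) : l2 (fun j => c * f j) = c * l2 f := by
  simp only [l2, mul_pow, tsum_mul_left]
  rw [Real.sqrt_mul (sq_nonneg c), Real.sqrt_sq hc]

theorem le_l2 (sf : Summable fun j => f j ^ 2) (j : J) : f j ≤ l2 f :=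
  Real.le_sqrt_of_sq_le (sf.le_tsum j fun _ _ => sq_nonneg _)

theorem l2_mono (hf : ∀ j, 0 ≤ f j) (hfg : ∀ j, f j ≤ g j) (sg : Summable fun j => g j ^ 2) :
    l2 f ≤ l2 g := by
  have h : ∀ j, f j ^ 2 ≤ g j ^ 2 := fun j => pow_le_pow_left₀ (hf j) (hfg j) 2
  exact Real.sqrt_le_sqrt
    ((Summable.of_nonneg_of_le (fun _ => sq_nonneg _) h sg).tsum_le_tsum h sg)

theorem l2_le_iff {c : ℝ} (hc : 0 ≤ c) (sf : Summable fun j => f j ^ 2) :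
    l2 f ≤ c ↔ ∀ F : Finset J, ∑ j ∈ F, f j ^ 2 ≤ c ^ 2 := by
  rw [l2, Real.sqrt_le_left hc]
  constructor
  · exact fun h F => (sf.sum_le_tsum F fun _ _ => sq_nonneg _).trans h
  · exact fun h => sf.tsum_le_of_sum_le h

/-- The convexity defect of the `ℓ²` norm dominates the convexity defect of each term. -/
theorem l2_defect (sf : Summable fun j => f j ^ 2) (sg : Summable fun j => g j ^ 2) (h : J → ℝ)
    (hh : ∀ j, 0 ≤ h j) (hle : ∀ j, h j ≤ f j + g j) (j : J) :
    2 * f j ^ 2 + 2 * g j ^ 2 - h j ^ 2 ≤ 2 * l2 f ^ 2 + 2 * l2 g ^ 2 - l2 h ^ 2 := by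
  have h1 : ∀ j, h j ^ 2 ≤ (f j + g j) ^ 2 := fun j => pow_le_pow_left₀ (hh j) (hle j) 2
  have sh : Summable fun j => h j ^ 2 :=
    .of_nonneg_of_le (fun _ => sq_nonneg _) h1 (summable_add_sq sf sg)
  have hs := ((sf.hasSum.mul_left 2).add (sg.hasSum.mul_left 2)).sub sh.hasSum
  rw [l2_sq, l2_sq, l2_sq, ← hs.tsum_eq]
  -- Every term of the defect is at least `(f i - g i) ^ 2`, so one term is bounded by the sum.
  refine hs.summable.le_tsum j fun i _ => ?_
  nlinarith [h1 i, sq_nonneg (f i - g i)]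

end L2

/-! ### Summing sublinear functionals into one dual norm. -/

section SumNorm

variable {X : Type*} [NormedAddCommGroup X] [NormedSpace ℝ X]

/-- The weighted `ℓ²` sum of a family of weak* lower semicontinuous sublinear functionals
comparable with an equivalent norm is an equivalent dual norm. -/
theorem exists_isEquivalentDualNorm_l2 {I : Type*} [Nonempty I]
    {p : Seminorm ℝ (StrongDual ℝ X)} (hp : IsEquivalentNorm p)
    (N : I → StrongDual ℝ X → ℝ) (w : I → ℝ) (hw : ∀ i, 0 < w i) (hws : Summable fun i => w i ^ 2)
    {K : ℝ} (hK : 0 < K) (low : ∀ i f, p f ≤ N i f) (upp : ∀ i f, N i f ≤ K * p f)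
    (sub : ∀ i f g, N i (f + g) ≤ N i f + N i g)
    (hom : ∀ i (c : ℝ) f, 0 ≤ c → N i (c • f) = c * N i f)
    (lsc : ∀ i c, IsClosed {f : WeakDual ℝ X | N i (WeakDual.toStrongDual f) ≤ c})
    (σ : I ≃ I) (hσ : ∀ i f, N (σ i) f = N i (-f)) (hwσ : ∀ i, w (σ i) = w i) :
    ∃ A : Seminorm ℝ (StrongDual ℝ X), IsEquivalentDualNorm A ∧
      ∀ i f g, w i ^ 2 * (2 * N i f ^ 2 + 2 * N i g ^ 2 - N i (f + g) ^ 2) ≤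
        2 * A f ^ 2 + 2 * A g ^ 2 - A (f + g) ^ 2 := by
  have N0 : ∀ i f, 0 ≤ N i f := fun i f => (apply_nonneg p f).trans (low i f)
  have wN0 : ∀ f i, 0 ≤ w i * N i f := fun f i => mul_nonneg (hw i).le (N0 i f)
  have hle : ∀ f i, w i * N i f ≤ (K * p f) * w i := fun f i => by
    rw [mul_comm]; exact mul_le_mul_of_nonneg_right (upp i f) (hw i).le
  have sw : ∀ f, Summable fun i => ((K * p f) * w i) ^ 2 := fun f => by
    simp only [mul_pow]; exact hws.mul_left _
  have sN : ∀ f, Summable fun i => (w i * N i f) ^ 2 := fun f =>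
    .of_nonneg_of_le (fun _ => sq_nonneg _)
      (fun i => pow_le_pow_left₀ (wN0 f i) (hle f i) 2) (sw f)
  have wsub : ∀ f g i, w i * N i (f + g) ≤ w i * N i f + w i * N i g := fun f g i => by
    rw [← mul_add]; exact mul_le_mul_of_nonneg_left (sub i f g) (hw i).le
  let a : StrongDual ℝ X → ℝ := fun f => l2 fun i => w i * N i f
  have a_hom : ∀ (c : ℝ) f, 0 ≤ c → a (c • f) = c * a f := fun c f hc => by
    simp only [a]
    rw [← l2_mul_left hc]
    congr 1
    funext i
    rw [hom i c f hc]; ring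
  -- The `N i` need not be even; evenness of the sum comes from the permutation `σ`.
  have a_neg : ∀ f, a (-f) = a f := fun f => by
    simp only [a, l2]
    congr 1
    rw [← σ.tsum_eq (fun i => (w i * N i f) ^ 2)]
    simp only [hσ, hwσ]
  let A : Seminorm ℝ (StrongDual ℝ X) := Seminorm.of a
    (fun f g => (l2_mono (wN0 _) (wsub f g) (summable_add_sq (sN f) (sN g))).trans
      (l2_add_le (wN0 f) (wN0 g) (sN f) (sN g)))
    (fun c f => by
      rcases le_total 0 c with hc | hc
      · rw [a_hom c f hc, Real.norm_of_nonneg hc]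
      · rw [← a_neg, ← neg_smul, a_hom (-c) f (neg_nonneg.2 hc), Real.norm_of_nonpos hc])
  have hA : ∀ f, A f = l2 fun i => w i * N i f := fun f => rfl
  have A_upp : ∀ f, A f ≤ (K * l2 w) * p f := fun f => by
    refine (l2_mono (wN0 f) (hle f) (sw f)).trans ?_
    rw [l2_mul_left (mul_nonneg hK.le (apply_nonneg p f))]
    exact le_of_eq (by ring)
  obtain ⟨i₀⟩ := ‹Nonempty I›
  have A_low : ∀ f, w i₀ * p f ≤ A f := fun f =>
    (mul_le_mul_of_nonneg_left (low i₀ f) (hw i₀).le).trans (le_l2 (sN f) i₀)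
  have hl2w : 0 < l2 w := (hw i₀).trans_le (le_l2 hws i₀)
  refine ⟨A, IsEquivalentNorm.isEquivalentDualNorm ?_ ?_, ?_⟩
  · obtain ⟨c, C, hc, hC, h⟩ := hp
    refine ⟨w i₀ * c, K * l2 w * C, mul_pos (hw i₀) hc, by positivity, fun f => ⟨?_, ?_⟩⟩
    · refine le_trans ?_ (A_low f)
      rw [mul_assoc]
      exact mul_le_mul_of_nonneg_left (h f).1 (hw i₀).le
    · refine (A_upp f).trans ?_
      rw [mul_assoc _ C]
      exact mul_le_mul_of_nonneg_left (h f).2 (by positivity)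
  · have : {f : WeakDual ℝ X | A (WeakDual.toStrongDual f) ≤ 1} = ⋂ F : Finset I,
        {f : WeakDual ℝ X | ∑ i ∈ F, (w i * N i (WeakDual.toStrongDual f)) ^ 2 ≤ 1 ^ 2} := by
      ext f
      simp only [Set.mem_ofPred_eq, Set.mem_iInter]
      exact l2_le_iff zero_le_one (sN _)
    rw [this]
    refine isClosed_iInter fun F => ?_
    have l1 : ∀ i, LowerSemicontinuous fun f : WeakDual ℝ X =>
        (w i * N i (WeakDual.toStrongDual f)) ^ 2 := by
      intro i
      rw [lowerSemicontinuous_iff_isClosed_preimage]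
      intro y
      rcases lt_or_ge y 0 with hy | hy
      · convert! isClosed_empty
        ext f
        simp only [Set.mem_preimage, Set.mem_Iic, Set.mem_empty_iff_false, iff_false, not_le]
        exact hy.trans_le (sq_nonneg _)
      · convert! lsc i (√y / w i) using 1
        ext f
        simp only [Set.mem_preimage, Set.mem_Iic, Set.mem_ofPred_eq]
        rw [le_div_iff₀ (hw i), mul_comm (N i _), Real.le_sqrt (wN0 _ i) hy]
    exact (lowerSemicontinuous_iff_isClosed_preimage.1
      (lowerSemicontinuous_sum fun i _ => l1 i)) (1 ^ 2)
  · intro i f g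
    have := l2_defect (sN f) (sN g) (fun i => w i * N i (f + g)) (wN0 _) (wsub f g) i
    rw [hA, hA, hA]
    refine le_trans (le_of_eq ?_) this
    ring

end SumNorm

/-! ### Positive lifts and quotient norms. -/

section Lifts

variable {X : Type*} [NormedAddCommGroup X] [NormedSpace ℝ X] {T : Type*} [TopologicalSpace T]

/-- The positive functionals on the bounded continuous functions. -/
def positiveDual (T : Type*) [TopologicalSpace T] : Set (WeakDual ℝ (T →ᵇ ℝ)) :=
  {α | ∀ g : T →ᵇ ℝ, 0 ≤ g → 0 ≤ α g}

/-- The positive functionals that represent `f` along `ev`. -/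
def positiveLifts (ev : X →L[ℝ] (T →ᵇ ℝ)) (f : StrongDual ℝ X) : Set (WeakDual ℝ (T →ᵇ ℝ)) :=
  {α | α ∈ positiveDual T ∧ ∀ v, α (ev v) = f v}

/-- The quotient of the `ℓ²` norm of the values at a family `e`. -/
noncomputable def quotientNorm {J : Type*} (ev : X →L[ℝ] (T →ᵇ ℝ)) (e : J → T →ᵇ ℝ)
    (f : StrongDual ℝ X) : ℝ :=
  sInf ((fun α : WeakDual ℝ (T →ᵇ ℝ) => l2 fun j => α (e j)) '' positiveLifts ev f)

/-- A family of nonnegative functions that contains `1` and has sums bounded by `K`. -/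
structure IsUnitalFamily {J : Type*} (e : J → T →ᵇ ℝ) (K : ℝ) : Prop where
  nonneg : ∀ j, 0 ≤ e j
  sum_le : ∀ F : Finset J, ∑ j ∈ F, e j ≤ K • 1
  one_mem : ∃ j, e j = 1

/-- Every functional has a positive lift of the same norm, and no smaller ones. -/
structure HasPositiveLifts (p : Seminorm ℝ (StrongDual ℝ X)) (ev : X →L[ℝ] (T →ᵇ ℝ)) : Prop where
  le_mass : ∀ f, ∀ α ∈ positiveLifts ev f, p f ≤ α 1
  exists_lift : ∀ f, ∃ α ∈ positiveLifts ev f, α 1 = p f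

theorem positiveDual_mono {α : WeakDual ℝ (T →ᵇ ℝ)} (hα : α ∈ positiveDual T) {g h : T →ᵇ ℝ}
    (hgh : g ≤ h) : α g ≤ α h := by
  have := hα (h - g) (sub_nonneg.2 hgh)
  rw [map_sub] at this
  linarith

theorem abs_le_of_positiveDual {α : WeakDual ℝ (T →ᵇ ℝ)} (hα : α ∈ positiveDual T)
    {g h : T →ᵇ ℝ} (hgh : ∀ x, |g x| ≤ h x) : |α g| ≤ α h := by
  have h1 : -h ≤ g := fun x => (abs_le.1 (hgh x)).1
  have h2 : g ≤ h := fun x => (abs_le.1 (hgh x)).2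
  have h3 := positiveDual_mono hα h1
  rw [map_neg] at h3
  exact abs_le.2 ⟨h3, positiveDual_mono hα h2⟩

theorem mass_nonneg {α : WeakDual ℝ (T →ᵇ ℝ)} (hα : α ∈ positiveDual T) : 0 ≤ α 1 :=
  hα 1 fun _ => zero_le_one

theorem abs_le_mass_mul_norm {α : WeakDual ℝ (T →ᵇ ℝ)} (hα : α ∈ positiveDual T) (g : T →ᵇ ℝ) :
    |α g| ≤ α 1 * ‖g‖ := by
  have : |α g| ≤ α (‖g‖ • (1 : T →ᵇ ℝ)) := abs_le_of_positiveDual hα fun x => by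
    simpa using g.norm_coe_le_norm x
  rw [map_smul, smul_eq_mul] at this
  linarith

theorem isClosed_positiveDual : IsClosed (positiveDual T) := by
  simp only [positiveDual, Set.ofPred_forall]
  exact isClosed_iInter fun g => isClosed_iInter fun _ =>
    isClosed_le continuous_const (WeakDual.eval_continuous g)

theorem isCompact_positiveDual_mass_le (c : ℝ) :
    IsCompact {α : WeakDual ℝ (T →ᵇ ℝ) | α ∈ positiveDual T ∧ α 1 ≤ c} := by
  refine (WeakDual.isCompact_closedBall (𝕜 := ℝ) (E := T →ᵇ ℝ) 0 c).of_isClosed_subset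
    (isClosed_positiveDual.inter (isClosed_le (WeakDual.eval_continuous _) continuous_const)) ?_
  rintro α ⟨hα, hc⟩
  simp only [Set.mem_preimage, Metric.mem_closedBall, dist_zero_right]
  refine ContinuousLinearMap.opNorm_le_bound _ ((mass_nonneg hα).trans hc) fun g => ?_
  exact (abs_le_mass_mul_norm hα g).trans (mul_le_mul_of_nonneg_right hc (norm_nonneg g))

theorem isClosed_positiveLifts (ev : X →L[ℝ] (T →ᵇ ℝ)) (f : StrongDual ℝ X) :
    IsClosed (positiveLifts ev f) := by
  have : positiveLifts ev f = positiveDual T ∩ ⋂ v, {α | α (ev v) = f v} := by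
    ext α
    simp [positiveLifts]
  rw [this]
  exact isClosed_positiveDual.inter (isClosed_iInter fun v =>
    isClosed_eq (WeakDual.eval_continuous _) continuous_const)

theorem add_mem_positiveLifts {ev : X →L[ℝ] (T →ᵇ ℝ)} {f g : StrongDual ℝ X}
    {α β : WeakDual ℝ (T →ᵇ ℝ)} (hα : α ∈ positiveLifts ev f) (hβ : β ∈ positiveLifts ev g) :
    α + β ∈ positiveLifts ev (f + g) :=
  ⟨fun h hh => add_nonneg (hα.1 h hh) (hβ.1 h hh), fun v => congr_arg₂ (· + ·) (hα.2 v) (hβ.2 v)⟩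

theorem smul_mem_positiveLifts {ev : X →L[ℝ] (T →ᵇ ℝ)} {f : StrongDual ℝ X} {c : ℝ} (hc : 0 ≤ c)
    {α : WeakDual ℝ (T →ᵇ ℝ)} (hα : α ∈ positiveLifts ev f) : c • α ∈ positiveLifts ev (c • f) :=
  ⟨fun h hh => mul_nonneg hc (hα.1 h hh), fun v => congr_arg (c * ·) (hα.2 v)⟩

namespace IsUnitalFamily

variable {J : Type*} {e : J → T →ᵇ ℝ} {K : ℝ} {α β : WeakDual ℝ (T →ᵇ ℝ)}

theorem apply_nonneg (he : IsUnitalFamily e K) (hα : α ∈ positiveDual T) (j : J) : 0 ≤ α (e j) :=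
  hα _ (he.nonneg j)

theorem sum_sq_le (he : IsUnitalFamily e K) (hα : α ∈ positiveDual T) (F : Finset J) :
    ∑ j ∈ F, α (e j) ^ 2 ≤ (K * α 1) ^ 2 := by
  have h1 : ∑ j ∈ F, α (e j) ≤ K * α 1 := by
    have := positiveDual_mono hα (he.sum_le F)
    rwa [map_sum, map_smul, smul_eq_mul] at this
  exact (Finset.sum_sq_le_sq_sum_of_nonneg fun j _ => he.apply_nonneg hα j).trans
    (pow_le_pow_left₀ (Finset.sum_nonneg fun j _ => he.apply_nonneg hα j) h1 2)

theorem summable (he : IsUnitalFamily e K) (hα : α ∈ positiveDual T) :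
    Summable fun j => α (e j) ^ 2 :=
  summable_of_sum_le (fun _ => sq_nonneg _) (he.sum_sq_le hα)

theorem mass_le_l2 (he : IsUnitalFamily e K) (hα : α ∈ positiveDual T) :
    α 1 ≤ l2 fun j => α (e j) := by
  obtain ⟨j, hj⟩ := he.one_mem
  rw [← hj]
  exact le_l2 (he.summable hα) j

theorem l2_le_mul_mass (he : IsUnitalFamily e K) (hK : 0 ≤ K) (hα : α ∈ positiveDual T) :
    (l2 fun j => α (e j)) ≤ K * α 1 :=
  (l2_le_iff (mul_nonneg hK (mass_nonneg hα)) (he.summable hα)).2 (he.sum_sq_le hα)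

theorem l2_add_le (he : IsUnitalFamily e K) (hα : α ∈ positiveDual T) (hβ : β ∈ positiveDual T) :
    (l2 fun j => (α + β) (e j)) ≤ (l2 fun j => α (e j)) + l2 fun j => β (e j) :=
  _root_.l2_add_le (he.apply_nonneg hα) (he.apply_nonneg hβ) (he.summable hα) (he.summable hβ)

theorem isCompact_l2_le (he : IsUnitalFamily e K) (c : ℝ) :
    IsCompact {α : WeakDual ℝ (T →ᵇ ℝ) | α ∈ positiveDual T ∧ (l2 fun j => α (e j)) ≤ c} := by
  rcases lt_or_ge c 0 with hc | hc
  · convert! isCompact_empty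
    ext α
    simp only [Set.mem_ofPred_eq, Set.mem_empty_iff_false, iff_false, not_and, not_le]
    exact fun _ => hc.trans_le (l2_nonneg _)
  · refine (isCompact_positiveDual_mass_le c).of_isClosed_subset ?_
      fun α hα => ⟨hα.1, (he.mass_le_l2 hα.1).trans hα.2⟩
    have : {α : WeakDual ℝ (T →ᵇ ℝ) | α ∈ positiveDual T ∧ (l2 fun j => α (e j)) ≤ c} =
        positiveDual T ∩ ⋂ F : Finset J, {α | ∑ j ∈ F, α (e j) ^ 2 ≤ c ^ 2} := by
      ext α
      simp only [Set.mem_ofPred_eq, Set.mem_inter_iff, Set.mem_iInter]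
      exact and_congr_right fun hα => l2_le_iff hc (he.summable hα)
    rw [this]
    exact isClosed_positiveDual.inter (isClosed_iInter fun F => isClosed_le
      (continuous_finsetSum _ fun j _ => (WeakDual.eval_continuous _).pow 2) continuous_const)

end IsUnitalFamily

section QuotientNorm

variable {J : Type*} {e : J → T →ᵇ ℝ} {K : ℝ} {ev : X →L[ℝ] (T →ᵇ ℝ)}
  {p : Seminorm ℝ (StrongDual ℝ X)} {f g : StrongDual ℝ X} {α β : WeakDual ℝ (T →ᵇ ℝ)}

theorem quotientNorm_le (hα : α ∈ positiveLifts ev f) :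
    quotientNorm ev e f ≤ l2 fun j => α (e j) := by
  refine csInf_le ⟨0, ?_⟩ ⟨α, hα, rfl⟩
  rintro _ ⟨β, -, rfl⟩
  exact l2_nonneg _

/-- The sublevel sets above the infimum are nested, nonempty and weak* compact, since membership of
`1` in the family makes the `ℓ²` norm control the mass. -/
theorem exists_quotientNorm_eq (he : IsUnitalFamily e K) (hev : HasPositiveLifts p ev)
    (f : StrongDual ℝ X) :
    ∃ α ∈ positiveLifts ev f, (l2 fun j => α (e j)) = quotientNorm ev e f := by
  let S : Set ℝ := (fun α : WeakDual ℝ (T →ᵇ ℝ) => l2 fun j => α (e j)) '' positiveLifts ev f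
  let C : {c : ℝ // quotientNorm ev e f < c} → Set (WeakDual ℝ (T →ᵇ ℝ)) := fun c =>
    {α | α ∈ positiveDual T ∧ (l2 fun j => α (e j)) ≤ c.1} ∩ positiveLifts ev f
  have hne : S.Nonempty := by
    obtain ⟨α, hα, -⟩ := hev.exists_lift f
    exact ⟨_, α, hα, rfl⟩
  have : Nonempty {c : ℝ // quotientNorm ev e f < c} := ⟨⟨_, lt_add_one _⟩⟩
  obtain ⟨α, hα⟩ := IsCompact.nonempty_iInter_of_directed_nonempty_isCompact_isClosed C
    (by
      intro a b
      refine ⟨⟨min a.1 b.1, lt_min a.2 b.2⟩, fun α hα => ?_, fun α hα => ?_⟩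
      · exact ⟨⟨hα.1.1, hα.1.2.trans (min_le_left _ _)⟩, hα.2⟩
      · exact ⟨⟨hα.1.1, hα.1.2.trans (min_le_right _ _)⟩, hα.2⟩)
    (by
      rintro ⟨c, hc⟩
      obtain ⟨_, ⟨α, hα, rfl⟩, h⟩ := exists_lt_of_csInf_lt hne hc
      exact ⟨α, ⟨hα.1, h.le⟩, hα⟩)
    (fun c => (he.isCompact_l2_le c.1).inter_right (isClosed_positiveLifts ev f))
    (fun c => (he.isCompact_l2_le c.1).isClosed.inter (isClosed_positiveLifts ev f))
  rw [Set.mem_iInter] at hα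
  have hlift := (hα ⟨_, lt_add_one _⟩).2
  refine ⟨α, hlift, le_antisymm (le_of_forall_gt fun c hc => ?_) (quotientNorm_le hlift)⟩
  obtain ⟨d, hd, hdc⟩ := exists_between hc
  exact ((hα ⟨d, hd⟩).1.2).trans_lt hdc

theorem le_quotientNorm (he : IsUnitalFamily e K) (hev : HasPositiveLifts p ev)
    (f : StrongDual ℝ X) : p f ≤ quotientNorm ev e f := by
  obtain ⟨α, hα, h⟩ := exists_quotientNorm_eq he hev f
  rw [← h]
  exact (hev.le_mass f α hα).trans (he.mass_le_l2 hα.1)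

theorem quotientNorm_le_mul (he : IsUnitalFamily e K) (hK : 0 ≤ K) (hev : HasPositiveLifts p ev)
    (f : StrongDual ℝ X) : quotientNorm ev e f ≤ K * p f := by
  obtain ⟨α, hα, h⟩ := hev.exists_lift f
  rw [← h]
  exact (quotientNorm_le hα).trans (he.l2_le_mul_mass hK hα.1)

theorem quotientNorm_add_le (he : IsUnitalFamily e K) (hev : HasPositiveLifts p ev)
    (f g : StrongDual ℝ X) :
    quotientNorm ev e (f + g) ≤ quotientNorm ev e f + quotientNorm ev e g := by
  obtain ⟨α, hα, h⟩ := exists_quotientNorm_eq he hev f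
  obtain ⟨β, hβ, h'⟩ := exists_quotientNorm_eq he hev g
  rw [← h, ← h']
  exact (quotientNorm_le (add_mem_positiveLifts hα hβ)).trans (he.l2_add_le hα.1 hβ.1)

theorem quotientNorm_smul (he : IsUnitalFamily e K) (hev : HasPositiveLifts p ev)
    {c : ℝ} (hc : 0 ≤ c) (f : StrongDual ℝ X) :
    quotientNorm ev e (c • f) = c * quotientNorm ev e f := by
  have key : ∀ (c : ℝ) (f : StrongDual ℝ X), 0 ≤ c →
      quotientNorm ev e (c • f) ≤ c * quotientNorm ev e f := by
    intro c f hc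
    obtain ⟨α, hα, h⟩ := exists_quotientNorm_eq he hev f
    rw [← h, ← l2_mul_left hc]
    exact quotientNorm_le (smul_mem_positiveLifts hc hα)
  refine le_antisymm (key c f hc) ?_
  rcases hc.eq_or_lt with rfl | hc
  · rw [zero_mul]
    exact (apply_nonneg p _).trans (le_quotientNorm he hev _)
  · have := key c⁻¹ (c • f) (inv_nonneg.2 hc.le)
    rw [smul_smul, inv_mul_cancel₀ hc.ne', one_smul, inv_mul_eq_div, le_div_iff₀ hc] at this
    linarith

/-- As the infimum is attained, the sublevel set is the image of a weak* compact set under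
restriction along `ev`. -/
theorem isClosed_quotientNorm_le (he : IsUnitalFamily e K) (hev : HasPositiveLifts p ev) (c : ℝ) :
    IsClosed {f : WeakDual ℝ X | quotientNorm ev e (WeakDual.toStrongDual f) ≤ c} := by
  let R : WeakDual ℝ (T →ᵇ ℝ) → WeakDual ℝ X := fun α =>
    StrongDual.toWeakDual ((WeakDual.toStrongDual α).comp ev)
  have hR : Continuous R :=
    WeakDual.continuous_of_continuous_eval fun v => WeakDual.eval_continuous (ev v)
  convert! ((he.isCompact_l2_le c).image hR).isClosed using 1
  ext f
  constructor
  · intro hf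
    obtain ⟨α, hα, h⟩ := exists_quotientNorm_eq he hev (WeakDual.toStrongDual f)
    refine ⟨α, ⟨hα.1, h.le.trans hf⟩, ?_⟩
    exact DFunLike.ext _ _ fun v => hα.2 v
  · rintro ⟨α, ⟨hα, h⟩, rfl⟩
    exact (quotientNorm_le (f := WeakDual.toStrongDual (R α)) ⟨hα, fun _ => rfl⟩).trans h

/-- The convexity defect of a quotient norm controls the distance of optimal lifts. -/
theorem quotientNorm_defect (he : IsUnitalFamily e K) (hev : HasPositiveLifts p ev)
    (hα : α ∈ positiveLifts ev f) (hβ : β ∈ positiveLifts ev g)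
    (hfα : (l2 fun j => α (e j)) = quotientNorm ev e f)
    (hgβ : (l2 fun j => β (e j)) = quotientNorm ev e g) (j : J) :
    (α (e j) - β (e j)) ^ 2 ≤
      2 * quotientNorm ev e f ^ 2 + 2 * quotientNorm ev e g ^ 2 - quotientNorm ev e (f + g) ^ 2 := by
  have h1 := l2_defect (he.summable hα.1) (he.summable hβ.1) (fun j => (α + β) (e j))
    (fun j => add_nonneg (he.apply_nonneg hα.1 j) (he.apply_nonneg hβ.1 j)) (fun j => le_rfl) j
  have h2 := quotientNorm_le (e := e) (add_mem_positiveLifts hα hβ)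
  have h3 : 0 ≤ quotientNorm ev e (f + g) :=
    (apply_nonneg p _).trans (le_quotientNorm he hev _)
  have h4 := pow_le_pow_left₀ h3 h2 2
  have h5 : (α + β) (e j) = α (e j) + β (e j) := rfl
  rw [hfα, hgβ, h5] at h1
  -- `2 a² + 2 b² - (a + b)² = (a - b)²`, and replacing the `ℓ²` norm of `α + β` by the smaller
  -- quotient norm only enlarges the defect.
  nlinarith

end QuotientNorm

end Lifts

/-! ### Partitions of unity and the weighted family built from them. -/

/-- A metrizable space has a sequence of partitions of unity such that on each compact set, every
bounded continuous function is nearly constant on the members of a finite subfamily of one of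
them that sums to `1` there. -/
theorem exists_partitions_of_unity (T : Type*) [TopologicalSpace T]
    [TopologicalSpace.MetrizableSpace T] :
    ∃ φ : ℕ → T → T →ᵇ ℝ, (∀ k s, 0 ≤ φ k s) ∧ (∀ k (F : Finset T), ∑ s ∈ F, φ k s ≤ 1) ∧
      ∀ C : Set T, IsCompact C → ∀ (g : T →ᵇ ℝ) (ε : ℝ), 0 < ε →
        ∃ (k : ℕ) (F : Finset T) (c : T → ℝ), (∀ x ∈ C, ∑ s ∈ F, φ k s x = 1) ∧
          ∀ s ∈ F, ∀ x, φ k s x ≠ 0 → |g x - c s| ≤ ε := by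
  let _ : MetricSpace T := TopologicalSpace.metrizableSpaceMetric T
  have hpart : ∀ k : ℕ, ∃ f : PartitionOfUnity T T Set.univ,
      f.IsSubordinate fun s => Metric.ball s (1 / ((k : ℝ) + 1)) := fun k =>
    PartitionOfUnity.exists_isSubordinate isClosed_univ _ (fun _ => Metric.isOpen_ball)
      fun x _ => Set.mem_iUnion.2 ⟨x, Metric.mem_ball_self (by positivity)⟩
  choose f hf using hpart
  have bound : ∀ k s x, ‖f k s x‖ ≤ 1 := fun k s x => by
    rw [Real.norm_of_nonneg ((f k).nonneg s x)]; exact (f k).le_one s x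
  let φ : ℕ → T → T →ᵇ ℝ := fun k s =>
    BoundedContinuousFunction.ofNormedAddCommGroup (f k s) (f k s).continuous 1 (bound k s)
  have hφ : ∀ k s x, φ k s x = f k s x := fun _ _ _ => rfl
  refine ⟨φ, fun k s x => (f k).nonneg s x, fun k F x => ?_, ?_⟩
  · change (∑ s ∈ F, φ k s : T →ᵇ ℝ) x ≤ (1 : ℝ)
    rw [BoundedContinuousFunction.coe_sum, Finset.sum_apply]
    simp only [hφ]
    classical
    have h1 := (f k).sum_finsupport' (Set.mem_univ x)
      (Finset.subset_union_right (s₁ := F) (s₂ := (f k).finsupport x))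
    rw [← h1]
    exact Finset.sum_le_sum_of_subset_of_nonneg Finset.subset_union_left
      fun s _ _ => (f k).nonneg s x
  · intro C hC g ε hε
    -- Near a compact set continuity is uniform even when only one of the two points lies in `C`.
    have hu := hC.uniformContinuousAt_of_continuousAt g (fun a _ => g.continuous.continuousAt)
      (Metric.dist_mem_uniformity hε)
    obtain ⟨δ, hδ, h⟩ := Metric.mem_uniformity_dist.1 hu
    obtain ⟨k, hk⟩ := exists_nat_one_div_lt (half_pos hδ)
    have hfin := (f k).locallyFinite.finite_nonempty_inter_compact hC
    -- `c s` is a value of `g` at a point of `C` where `f k s` is nonzero; the default `0` is never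
    -- used for `s` in the finite subfamily.
    have hch : ∀ s : T, ∃ c : ℝ, (Function.support (f k s) ∩ C).Nonempty →
        ∃ y ∈ C, f k s y ≠ 0 ∧ c = g y := by
      intro s
      by_cases hs : (Function.support (f k s) ∩ C).Nonempty
      · obtain ⟨y, hy, hyC⟩ := hs
        exact ⟨g y, fun _ => ⟨y, hyC, hy, rfl⟩⟩
      · exact ⟨0, fun h => absurd h hs⟩
    choose c hc using hch
    refine ⟨k, hfin.toFinset, c, fun x hx => ?_, fun s hs x hsx => ?_⟩
    · refine (f k).sum_finsupport' (Set.mem_univ x) fun s hs => ?_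
      rw [Set.Finite.mem_toFinset]
      exact ⟨x, ((f k).mem_finsupport x).1 hs, hx⟩
    · obtain ⟨y, hyC, hy, hcy⟩ := hc s (by simpa using hs)
      have ball : ∀ z, f k s z ≠ 0 → dist z s < δ / 2 := fun z hz =>
        (Metric.mem_ball.1 (hf k s (subset_tsupport _ hz))).trans hk
      have hd : dist y x < δ := by
        have h1 := ball y hy
        have h2 := ball x hsx
        have h3 := dist_triangle_right y x s
        linarith
      have := h hd hyC
      rw [hcy, ← Real.dist_eq, dist_comm]
      exact le_of_lt this

section UnitalFamily

variable {T : Type*} [TopologicalSpace T]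

/-- The constant function `1` together with the weighted members of `φ`. -/
noncomputable def unitalFamily (φ : ℕ → T → T →ᵇ ℝ) (t : ℝ) : Option (ℕ × T) → T →ᵇ ℝ
  | none => 1
  | some a => (t * (1 / 2) ^ a.1) • φ a.1 a.2

theorem isUnitalFamily_unitalFamily {φ : ℕ → T → T →ᵇ ℝ} (h0 : ∀ k s, 0 ≤ φ k s)
    (h1 : ∀ k (F : Finset T), ∑ s ∈ F, φ k s ≤ 1) {t : ℝ} (ht : 0 ≤ t) :
    IsUnitalFamily (unitalFamily φ t) (1 + 2 * t) where
  nonneg j := by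
    cases j with
    | none => exact fun _ => zero_le_one
    | some a =>
      intro x
      exact mul_nonneg (by positivity) (h0 a.1 a.2 x)
  one_mem := ⟨none, rfl⟩
  sum_le F := by
    classical
    intro x
    change (∑ j ∈ F, unitalFamily φ t j : T →ᵇ ℝ) x ≤ (1 + 2 * t) * 1
    rw [BoundedContinuousFunction.coe_sum, Finset.sum_apply]
    have nn : ∀ j, 0 ≤ unitalFamily φ t j x := by
      intro j
      cases j with
      | none => exact zero_le_one
      | some a => exact mul_nonneg (by positivity) (h0 a.1 a.2 x)
    have hsub : F ⊆ Finset.insertNone (F.eraseNone) := by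
      intro j hj
      cases j with
      | none => simp
      | some a => simpa using hj
    refine (Finset.sum_le_sum_of_subset_of_nonneg hsub fun j _ _ => nn j).trans ?_
    rw [Finset.sum_insertNone]
    set G := F.eraseNone
    obtain ⟨n, hn⟩ := (G.image Prod.fst).exists_nat_subset_range
    -- Enlarging to a rectangle lets each level `k` contribute at most `t * (1 / 2) ^ k`.
    have hG : G ⊆ Finset.range n ×ˢ G.image Prod.snd := by
      intro a ha
      exact Finset.mem_product.2
        ⟨hn (Finset.mem_image_of_mem _ ha), Finset.mem_image_of_mem _ ha⟩
    have hsum : ∑ a ∈ G, unitalFamily φ t (some a) x ≤ 2 * t := by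
      refine (Finset.sum_le_sum_of_subset_of_nonneg hG fun j _ _ => nn _).trans ?_
      rw [Finset.sum_product]
      calc ∑ k ∈ Finset.range n, ∑ s ∈ G.image Prod.snd, unitalFamily φ t (some (k, s)) x
          ≤ ∑ k ∈ Finset.range n, t * (1 / 2) ^ k := by
            refine Finset.sum_le_sum fun k _ => ?_
            have : (∑ s ∈ G.image Prod.snd, φ k s : T →ᵇ ℝ) x ≤ 1 := h1 k (G.image Prod.snd) x
            rw [BoundedContinuousFunction.coe_sum, Finset.sum_apply] at this
            change ∑ s ∈ G.image Prod.snd, (t * (1 / 2) ^ k) * φ k s x ≤ _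
            rw [← Finset.mul_sum]
            exact mul_le_of_le_one_right (by positivity) this
        _ ≤ 2 * t := by
            rw [← Finset.mul_sum, mul_comm]
            exact mul_le_mul_of_nonneg_right (sum_geometric_two_le n) ht
    change (1 : ℝ) + _ ≤ (1 + 2 * t) * 1
    linarith

end UnitalFamily

/-! ### Lifts to the sphere and tightness at minimal mass. -/

section Sphere

variable {X : Type*} [NormedAddCommGroup X] [NormedSpace ℝ X] {p : Seminorm ℝ (StrongDual ℝ X)}

theorem IsEquivalentNorm.exists_sphereEval (hp : IsEquivalentNorm p) :
    ∃ ev : X →L[ℝ] (weakStarUnitSphere p →ᵇ ℝ), ∀ v s, ev v s = s.1 v := by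
  obtain ⟨c, C, hc, -, h⟩ := hp
  have bound : ∀ (v : X) (s : weakStarUnitSphere p), ‖s.1 v‖ ≤ c⁻¹ * ‖v‖ := by
    intro v s
    refine ((WeakDual.toStrongDual s.1).le_opNorm v).trans
      (mul_le_mul_of_nonneg_right ?_ (norm_nonneg v))
    rw [← one_div, le_div_iff₀ hc, mul_comm]
    exact (h _).1.trans s.2.le
  let L : X →ₗ[ℝ] (weakStarUnitSphere p →ᵇ ℝ) :=
    { toFun := fun v => BoundedContinuousFunction.ofNormedAddCommGroup (fun s => s.1 v)
        ((WeakDual.eval_continuous v).comp continuous_subtype_val) (c⁻¹ * ‖v‖) (bound v)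
      map_add' := fun v w => by
        ext s
        exact map_add (WeakDual.toStrongDual s.1) v w
      map_smul' := fun a v => by
        ext s
        exact map_smul (WeakDual.toStrongDual s.1) a v }
  exact ⟨L.mkContinuous c⁻¹ fun v => BoundedContinuousFunction.norm_ofNormedAddCommGroup_le _
    (by positivity) (bound v), fun _ _ => rfl⟩

variable {ev : X →L[ℝ] (weakStarUnitSphere p →ᵇ ℝ)}

/-- Vectors with `q v ≤ 1` are bounded by `1` on the sphere, so every lift has mass at least `p f`;
`p f` times evaluation at `(p f)⁻¹ • f` attains it. -/
theorem IsEquivalentDualNorm.hasPositiveLifts (hp : IsEquivalentDualNorm p)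
    (hev : ∀ v s, ev v s = s.1 v) : HasPositiveLifts p ev := by
  obtain ⟨⟨c, C, hc, -, h⟩, q, -, hq⟩ := hp
  constructor
  · intro f α hα
    refine (hq f).2 ?_
    rintro _ ⟨v, hv, rfl⟩
    simp only
    rw [← hα.2 v]
    refine abs_le_of_positiveDual hα.1 fun s => ?_
    rw [hev]
    exact ((hq (WeakDual.toStrongDual s.1)).1 ⟨v, hv, rfl⟩).trans s.2.le
  · intro f
    rcases (apply_nonneg p f).eq_or_lt with h0 | h0
    · have hf : f = 0 := by
        have := (h f).1
        rw [← h0] at this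
        have h3 : ‖f‖ ≤ 0 := by
          by_contra h4
          push Not at h4
          nlinarith
        exact norm_le_zero_iff.1 h3
      exact ⟨0, ⟨fun _ _ => le_rfl, fun v => by rw [hf]; rfl⟩, by rw [← h0]; rfl⟩
    · let s : weakStarUnitSphere p := ⟨StrongDual.toWeakDual ((p f)⁻¹ • f), by
        change p ((p f)⁻¹ • f) = 1
        rw [map_smul_eq_mul, Real.norm_of_nonneg (inv_nonneg.2 h0.le), inv_mul_cancel₀ h0.ne']⟩
      let α : StrongDual ℝ (weakStarUnitSphere p →ᵇ ℝ) :=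
        p f • BoundedContinuousFunction.evalCLM ℝ s
      have hα : ∀ g, StrongDual.toWeakDual α g = p f * g s := fun _ => rfl
      refine ⟨StrongDual.toWeakDual α, ⟨fun g hg => ?_, fun v => ?_⟩, ?_⟩
      · rw [hα]
        exact mul_nonneg h0.le (hg s)
      · rw [hα, hev]
        change p f * ((p f)⁻¹ * f v) = f v
        rw [mul_inv_cancel_left₀ h0.ne']
      · rw [hα]
        exact mul_one _

/-- A positive lift of minimal mass is concentrated on compact subsets of the sphere. -/
theorem IsEquivalentDualNorm.exists_isCompact_tight (hp : IsEquivalentDualNorm p)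
    (hev : ∀ v s, ev v s = s.1 v) {f : StrongDual ℝ X}
    {α : WeakDual ℝ (weakStarUnitSphere p →ᵇ ℝ)} (hα : α ∈ positiveLifts ev f) (hm : α 1 = p f)
    {ε : ℝ} (hε : 0 < ε) :
    ∃ C : Set (weakStarUnitSphere p), IsCompact C ∧ ∀ u : weakStarUnitSphere p →ᵇ ℝ, 0 ≤ u →
      u ≤ 1 → (∀ s ∈ C, u s = 0) → α u ≤ ε := by
  have hcl := hp.isClosed_sublevel 1
  have hcpt := hp.1.isCompact_sublevel hcl
  obtain ⟨-, q, -, hq⟩ := hp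
  -- The rate `4^-n` survives multiplication by `2^n` below, leaving a summable `2^-n`.
  have hv : ∀ n : ℕ, ∃ v : X, q v ≤ 1 ∧ p f - (1 / 4) ^ n < f v := by
    intro n
    have hlt : p f - (1 / 4) ^ n < p f := sub_lt_self _ (by positivity)
    obtain ⟨_, ⟨v, hv, rfl⟩, h⟩ := (lt_isLUB_iff (hq f)).1 hlt
    rcases abs_cases (f v) with ⟨h1, -⟩ | ⟨h1, -⟩
    · exact ⟨v, hv, by simpa only [h1] using h⟩
    · exact ⟨-v, by rw [map_neg_eq_map]; exact hv, by simpa only [h1, map_neg] using h⟩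
  choose v hqv hfv using hv
  have abs_le_p : ∀ (z : StrongDual ℝ X) n, |z (v n)| ≤ p z := fun z n =>
    (hq z).1 ⟨v n, hqv n, rfl⟩
  have hα1 := mass_nonneg hα.1
  obtain ⟨N, hN⟩ := exists_pow_lt_of_lt_one (show (0 : ℝ) < ε / 4 by positivity)
    (show (1 / 2 : ℝ) < 1 by norm_num)
  -- The sets `D M` are compact in the ball, and on their intersection `z (v n) → 1` forces norm
  -- one; the intersection is therefore a compact part of the sphere.
  let D : ℕ → Set (WeakDual ℝ X) := fun M => {z | p (WeakDual.toStrongDual z) ≤ 1} ∩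
    ⋂ n ∈ Finset.Ico N M, {z : WeakDual ℝ X | 1 - (1 / 2 : ℝ) ^ n ≤ z (v n)}
  have mem_D : ∀ z M, z ∈ D M ↔ p (WeakDual.toStrongDual z) ≤ 1 ∧
      ∀ n, N ≤ n → n < M → 1 - (1 / 2 : ℝ) ^ n ≤ z (v n) := by
    intro z M
    simp [D]
  have D_cpt : ∀ M, IsCompact (D M) := fun M => hcpt.inter_right
    (isClosed_biInter fun n _ => isClosed_le continuous_const (WeakDual.eval_continuous _))
  have D_anti : Antitone D := by
    intro M M' h z hz
    rw [mem_D] at hz ⊢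
    exact ⟨hz.1, fun n h1 h2 => hz.2 n h1 (h2.trans_le h)⟩
  have D_sphere : ∀ z, z ∈ ⋂ M, D M → z ∈ weakStarUnitSphere p := by
    intro z hz
    rw [Set.mem_iInter] at hz
    refine le_antisymm ((mem_D z 0).1 (hz 0)).1 ?_
    have h1 : Tendsto (fun n : ℕ => 1 - (1 / 2 : ℝ) ^ n) atTop (𝓝 (1 - 0)) :=
      tendsto_const_nhds.sub
        (tendsto_pow_atTop_nhds_zero_of_lt_one (by norm_num) (by norm_num))
    rw [sub_zero] at h1
    refine le_of_tendsto h1 (eventually_atTop.2 ⟨N, fun n hn => ?_⟩)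
    exact (((mem_D z (n + 1)).1 (hz _)).2 n hn (Nat.lt_succ_self n)).trans
      ((le_abs_self _).trans (abs_le_p (WeakDual.toStrongDual z) n))
  refine ⟨Subtype.val ⁻¹' ⋂ M, D M, ?_, fun u hu0 hu1 hu => ?_⟩
  · rw [Subtype.isCompact_iff, Subtype.image_preimage_coe,
      Set.inter_eq_right.2 D_sphere]
    exact (D_cpt 0).of_isClosed_subset (isClosed_iInter fun M => (D_cpt M).isClosed)
      (Set.iInter_subset D 0)
  · set η := ε / (2 * (α 1 + 1)) with hη
    have hη0 : 0 < η := by positivity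
    obtain ⟨O, hO, hOu⟩ := isOpen_induced_iff.1 (isOpen_lt u.continuous (continuous_const (y := η)))
    have mem_O : ∀ s : weakStarUnitSphere p, s.1 ∈ O ↔ u s < η := fun s => by
      rw [← Set.mem_preimage, hOu]; rfl
    obtain ⟨M, hM⟩ := exists_subset_nhds_of_isCompact (directed_of_isDirected_le D_anti) D_cpt
      (U := O) (fun z hz => hO.mem_nhds
        ((mem_O ⟨z, D_sphere z hz⟩).2 (by rw [hu _ hz]; exact hη0)))
    have hone : ∀ n (s : weakStarUnitSphere p), 0 ≤ 1 - s.1 (v n) := fun n s =>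
      sub_nonneg.2 ((le_abs_self _).trans ((abs_le_p (WeakDual.toStrongDual s.1) n).trans s.2.le))
    have hterm : ∀ n (s : weakStarUnitSphere p), 0 ≤ (2 : ℝ) ^ n * (1 - s.1 (v n)) := fun n s =>
      mul_nonneg (by positivity) (hone n s)
    -- By compactness `u < η` already on some `D M`; off `D M` a single summand is at least `1 ≥ u`.
    -- Minimality of the mass makes `α` small on the sum.
    have hle : u ≤ η • 1 + ∑ n ∈ Finset.Ico N M, (2 : ℝ) ^ n • (1 - ev (v n)) := by
      intro s
      have hval : (η • 1 + ∑ n ∈ Finset.Ico N M, (2 : ℝ) ^ n • (1 - ev (v n)) :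
          weakStarUnitSphere p →ᵇ ℝ) s =
          η + ∑ n ∈ Finset.Ico N M, (2 : ℝ) ^ n * (1 - s.1 (v n)) := by
        simp [hev]
      refine le_of_le_of_eq (b := η + ∑ n ∈ Finset.Ico N M, (2 : ℝ) ^ n * (1 - s.1 (v n))) ?_
        hval.symm
      change u s ≤ _
      by_cases hs : s.1 ∈ D M
      · have := (mem_O s).1 (hM hs)
        have h2 := Finset.sum_nonneg fun n (_ : n ∈ Finset.Ico N M) => hterm n s
        linarith
      · rw [mem_D] at hs
        push Not at hs
        obtain ⟨n, hn1, hn2, hn⟩ := hs s.2.le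
        have h3 : 1 ≤ (2 : ℝ) ^ n * (1 - s.1 (v n)) := by
          have h4 : (1 / 2 : ℝ) ^ n ≤ 1 - s.1 (v n) := by linarith
          have h5 := mul_le_mul_of_nonneg_left h4 (show (0 : ℝ) ≤ 2 ^ n by positivity)
          rwa [← mul_pow, mul_one_div_cancel two_ne_zero, one_pow] at h5
        have h6 := Finset.single_le_sum (fun n (_ : n ∈ Finset.Ico N M) => hterm n s)
          (Finset.mem_Ico.2 ⟨hn1, hn2⟩)
        have h7 : u s ≤ 1 := hu1 s
        linarith
    have h1 := positiveDual_mono hα.1 hle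
    rw [map_add, map_smul, map_sum] at h1
    have h2 : ∑ n ∈ Finset.Ico N M, α ((2 : ℝ) ^ n • (1 - ev (v n))) ≤
        ∑ n ∈ Finset.Ico N M, (1 / 2 : ℝ) ^ n := by
      refine Finset.sum_le_sum fun n _ => ?_
      rw [map_smul, map_sub, hα.2, hm, smul_eq_mul]
      have h4 : p f - f (v n) ≤ (1 / 4) ^ n := by linarith [hfv n]
      have h5 := mul_le_mul_of_nonneg_left h4 (show (0 : ℝ) ≤ 2 ^ n by positivity)
      rwa [← mul_pow, show (2 : ℝ) * (1 / 4) = 1 / 2 by norm_num] at h5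
    have h3 := geom_sum_Ico_le_of_lt_one (x := (1 / 2 : ℝ)) (m := N) (n := M)
      (by norm_num) (by norm_num)
    have h4 : η * α 1 ≤ ε / 2 := by
      rw [hη, div_mul_eq_mul_div, div_le_div_iff₀ (by positivity) two_pos]
      nlinarith
    rw [smul_eq_mul] at h1
    have h5 : (1 / 2 : ℝ) ^ N / (1 - 1 / 2) = 2 * (1 / 2) ^ N := by ring
    linarith

end Sphere

/-! ### The renorming and the implication (2) ⇒ (1). -/

section Renorming

variable {X : Type*} [NormedAddCommGroup X] [NormedSpace ℝ X] {p : Seminorm ℝ (StrongDual ℝ X)}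

/-- Optimal lifts for small weights are nearly concentrated on finite subfamilies. -/
theorem exists_tight_optimal_lift (hp : IsEquivalentDualNorm p)
    [TopologicalSpace.MetrizableSpace (weakStarUnitSphere p)]
    {ev : X →L[ℝ] (weakStarUnitSphere p →ᵇ ℝ)} (hev : ∀ v s, ev v s = s.1 v)
    {φ : ℕ → weakStarUnitSphere p → weakStarUnitSphere p →ᵇ ℝ} (h0 : ∀ k s, 0 ≤ φ k s)
    (h1 : ∀ k (F : Finset (weakStarUnitSphere p)), ∑ s ∈ F, φ k s ≤ 1)
    (h2 : ∀ C : Set (weakStarUnitSphere p), IsCompact C →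
      ∀ (g : weakStarUnitSphere p →ᵇ ℝ) (ε : ℝ), 0 < ε →
        ∃ (k : ℕ) (F : Finset (weakStarUnitSphere p)) (c : weakStarUnitSphere p → ℝ),
          (∀ x ∈ C, ∑ s ∈ F, φ k s x = 1) ∧ ∀ s ∈ F, ∀ x, φ k s x ≠ 0 → |g x - c s| ≤ ε)
    {f : StrongDual ℝ X} {α : ℕ → WeakDual ℝ (weakStarUnitSphere p →ᵇ ℝ)}
    (hα : ∀ m, α m ∈ positiveLifts ev f)
    (hαf : ∀ m, (l2 fun j => α m (unitalFamily φ ((1 / 2) ^ m) j)) =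
      quotientNorm ev (unitalFamily φ ((1 / 2) ^ m)) f)
    (g : weakStarUnitSphere p →ᵇ ℝ) {ε : ℝ} (hε : 0 < ε) :
    ∃ (m k : ℕ) (F : Finset (weakStarUnitSphere p)) (c : weakStarUnitSphere p → ℝ),
      α m (1 - ∑ s ∈ F, φ k s) ≤ ε ∧ ∀ s ∈ F, ∀ x, φ k s x ≠ 0 → |g x - c s| ≤ ε := by
  have hl := hp.hasPositiveLifts hev
  have he : ∀ m : ℕ, IsUnitalFamily (unitalFamily φ ((1 / 2) ^ m)) (1 + 2 * (1 / 2) ^ m) :=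
    fun m => isUnitalFamily_unitalFamily h0 h1 (by positivity)
  have mass : ∀ m, α m 1 ≤ (1 + 2 * (1 / 2) ^ m) * p f := fun m =>
    ((he m).mass_le_l2 (hα m).1).trans
      ((hαf m).le.trans (quotientNorm_le_mul (he m) (by positivity) hl f))
  have mass' : ∀ m, α m 1 ≤ 3 * p f := fun m => by
    refine (mass m).trans (mul_le_mul_of_nonneg_right ?_ (apply_nonneg p f))
    have : (1 / 2 : ℝ) ^ m ≤ 1 := pow_le_one₀ (by norm_num) (by norm_num)
    linarith
  let U : Ultrafilter ℕ := Ultrafilter.of atTop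
  have hU : (U : Filter ℕ) ≤ atTop := Ultrafilter.of_le atTop
  obtain ⟨β, -, hβ⟩ := (isCompact_positiveDual_mass_le (3 * p f)).ultrafilter_le_nhds
    (U.map α) (le_principal_iff.2 (Filter.mem_map.2
      (Eventually.of_forall fun m => ⟨(hα m).1, mass' m⟩)))
  have hlim : Tendsto α U (𝓝 β) := hβ
  have eval_lim : ∀ g, Tendsto (fun m => α m g) U (𝓝 (β g)) := fun g =>
    ((WeakDual.eval_continuous g).tendsto β).comp hlim
  have hβl : β ∈ positiveLifts ev f :=
    (isClosed_positiveLifts ev f).mem_of_tendsto hlim (Eventually.of_forall hα)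
  -- The masses are squeezed between `p f` and `(1 + 2 * 2^-m) * p f`, so the limit lift has minimal
  -- mass and is tight.
  have hβm : β 1 = p f := by
    refine le_antisymm ?_ (hl.le_mass f β hβl)
    have h3 : Tendsto (fun m : ℕ => (1 + 2 * (1 / 2 : ℝ) ^ m) * p f) U
        (𝓝 ((1 + 2 * 0) * p f)) :=
      (tendsto_const_nhds.add (((tendsto_pow_atTop_nhds_zero_of_lt_one (by norm_num)
        (by norm_num)).mono_left hU).const_mul 2)).mul_const _
    have := le_of_tendsto_of_tendsto' (eval_lim 1) h3 mass
    linarith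
  obtain ⟨C, hC, htight⟩ := hp.exists_isCompact_tight hev hβl hβm (half_pos hε)
  obtain ⟨k, F, c, hF1, hF2⟩ := h2 C hC g ε hε
  have hu : β (1 - ∑ s ∈ F, φ k s) ≤ ε / 2 := by
    refine htight _ (sub_nonneg.2 (h1 k F))
      (sub_le_self _ (Finset.sum_nonneg fun s _ => h0 k s)) fun s hs => ?_
    have := hF1 s hs
    simp [BoundedContinuousFunction.coe_sum, this]
  obtain ⟨m, hm⟩ := ((eval_lim (1 - ∑ s ∈ F, φ k s)).eventually
    (gt_mem_nhds (hu.trans_lt (half_lt_self hε)))).exists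
  exact ⟨m, k, F, c, hm.le, hF2⟩

/-- Apply `α` to `g - ∑ c φ = g (1 - ∑ φ) + ∑ (g - c) φ`. The error bound involves only values of
`α` at `1` and at the `φ s`, which the renorming controls. -/
theorem abs_sub_sum_le {T : Type*} [TopologicalSpace T] {φ : T → T →ᵇ ℝ} (h0 : ∀ s, 0 ≤ φ s)
    {F : Finset T} (h1 : ∑ s ∈ F, φ s ≤ 1) {g : T →ᵇ ℝ} {c : T → ℝ} {ε : ℝ} (hε : 0 ≤ ε)
    (h : ∀ s ∈ F, ∀ x, φ s x ≠ 0 → |g x - c s| ≤ ε) {α : WeakDual ℝ (T →ᵇ ℝ)}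
    (hα : α ∈ positiveDual T) :
    |α g - ∑ s ∈ F, c s * α (φ s)| ≤ ‖g‖ * α (1 - ∑ s ∈ F, φ s) + ε * α 1 := by
  have key : |α (g - ∑ s ∈ F, c s • φ s)| ≤ α (‖g‖ • (1 - ∑ s ∈ F, φ s) + ε • 1) := by
    refine abs_le_of_positiveDual hα fun x => ?_
    have e1 : (g - ∑ s ∈ F, c s • φ s : T →ᵇ ℝ) x =
        g x * (1 - ∑ s ∈ F, φ s x) + ∑ s ∈ F, (g x - c s) * φ s x := by
      simp only [sub_mul, Finset.sum_sub_distrib, ← Finset.mul_sum,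
        BoundedContinuousFunction.coe_sub, Pi.sub_apply, BoundedContinuousFunction.coe_sum,
        Finset.sum_apply, BoundedContinuousFunction.coe_smul, smul_eq_mul]
      ring
    have e2 : (‖g‖ • (1 - ∑ s ∈ F, φ s) + ε • 1 : T →ᵇ ℝ) x =
        ‖g‖ * (1 - ∑ s ∈ F, φ s x) + ε := by
      simp
    have h1x : ∑ s ∈ F, φ s x ≤ 1 := by
      have : (∑ s ∈ F, φ s : T →ᵇ ℝ) x ≤ 1 := h1 x
      rwa [BoundedContinuousFunction.coe_sum, Finset.sum_apply] at this
    rw [e1, e2]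
    refine (abs_add_le _ _).trans (add_le_add ?_ ?_)
    · rw [abs_mul, abs_of_nonneg (sub_nonneg.2 h1x)]
      exact mul_le_mul_of_nonneg_right (g.norm_coe_le_norm x) (sub_nonneg.2 h1x)
    · calc |∑ s ∈ F, (g x - c s) * φ s x| ≤ ∑ s ∈ F, |(g x - c s) * φ s x| :=
            Finset.abs_sum_le_sum_abs _ _
        _ ≤ ∑ s ∈ F, ε * φ s x := by
            refine Finset.sum_le_sum fun s hs => ?_
            have hφ : 0 ≤ φ s x := h0 s x
            rw [abs_mul, abs_of_nonneg hφ]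
            by_cases hz : φ s x = 0
            · simp [hz]
            · exact mul_le_mul_of_nonneg_right (h s hs x hz) hφ
        _ ≤ ε := by
            rw [← Finset.mul_sum]
            exact mul_le_of_le_one_right hε h1x
  rw [map_sub, map_sum, map_add, map_smul, map_smul, smul_eq_mul, smul_eq_mul] at key
  simpa only [map_smul, smul_eq_mul] using key

theorem tendsto_of_sub_sq_le {u v d : ℕ → ℝ} {l : ℝ} (hv : Tendsto v atTop (𝓝 l))
    (hd : Tendsto d atTop (𝓝 0)) (h : ∀ n, (v n - u n) ^ 2 ≤ d n) :
    Tendsto u atTop (𝓝 l) := by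
  have h1 : Tendsto (fun n => √(d n)) atTop (𝓝 0) := by
    have := (Real.continuous_sqrt.tendsto 0).comp hd
    rwa [Real.sqrt_zero] at this
  have h2 : Tendsto (fun n => v n - u n) atTop (𝓝 0) :=
    squeeze_zero_norm (fun n => Real.abs_le_sqrt (h n)) h1
  simpa using hv.sub h2

theorem exists_dualNorm_of_metrizableSpace_sphere (hp : IsEquivalentDualNorm p)
    [TopologicalSpace.MetrizableSpace (weakStarUnitSphere p)] :
    ∃ A : Seminorm ℝ (StrongDual ℝ X), IsEquivalentDualNorm A ∧
      ∀ (x y : ℕ → StrongDual ℝ X) (a : StrongDual ℝ X),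
        Tendsto (fun n => 2 * A (x n) ^ 2 + 2 * A (y n) ^ 2 - A (x n + y n) ^ 2) atTop (𝓝 0) →
        Tendsto (fun n => 2 * A a ^ 2 + 2 * A (x n) ^ 2 - A (a + x n) ^ 2) atTop (𝓝 0) →
        Tendsto (fun n => StrongDual.toWeakDual (y n)) atTop (𝓝 (StrongDual.toWeakDual a)) := by
  obtain ⟨ev, hev⟩ := hp.1.exists_sphereEval
  obtain ⟨φ, h0, h1, h2⟩ := exists_partitions_of_unity (weakStarUnitSphere p)
  have hl := hp.hasPositiveLifts hev
  let e : ℕ → Option (ℕ × weakStarUnitSphere p) → weakStarUnitSphere p →ᵇ ℝ := fun m =>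
    unitalFamily φ ((1 / 2) ^ m)
  have he : ∀ m : ℕ, IsUnitalFamily (e m) (1 + 2 * (1 / 2) ^ m) :=
    fun m => isUnitalFamily_unitalFamily h0 h1 (by positivity)
  have hK : ∀ m : ℕ, 1 + 2 * (1 / 2 : ℝ) ^ m ≤ 3 := fun m => by
    have : (1 / 2 : ℝ) ^ m ≤ 1 := pow_le_one₀ (by norm_num) (by norm_num)
    linarith
  -- Both signs are summed because positive lifts of `f` and `-f` are unrelated.
  let ι : Bool → StrongDual ℝ X →ₗ[ℝ] StrongDual ℝ X := fun b =>
    bif b then LinearMap.id else -LinearMap.id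
  have ι_cont : ∀ b, Continuous fun f : WeakDual ℝ X =>
      StrongDual.toWeakDual (ι b (WeakDual.toStrongDual f)) := by
    rintro (_ | _)
    · exact continuous_neg
    · exact continuous_id
  have pι : ∀ b f, p (ι b f) = p f := by
    rintro (_ | _) f
    · exact map_neg_eq_map p f
    · rfl
  obtain ⟨A, hA, hdef⟩ := exists_isEquivalentDualNorm_l2 (I := ℕ × Bool) hp.1
    (fun i f => quotientNorm ev (e i.1) (ι i.2 f)) (fun i => (1 / 2 : ℝ) ^ i.1)
    (fun i => by positivity)
    (by
      have := (summable_geometric_of_lt_one (r := (1 / 4 : ℝ)) (by norm_num)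
        (by norm_num)).mul_of_nonneg (g := fun _ : Bool => (1 : ℝ)) (Summable.of_finite)
        (fun n => by positivity) (fun _ => zero_le_one)
      refine this.congr fun i => ?_
      rw [mul_one, ← pow_mul, mul_comm, pow_mul]
      norm_num)
    (K := 3) (by norm_num)
    (fun i f => (pι i.2 f).symm.le.trans (le_quotientNorm (he i.1) hl _))
    (fun i f => (quotientNorm_le_mul (he i.1) (by positivity) hl _).trans (by
      rw [pι]; exact mul_le_mul_of_nonneg_right (hK i.1) (apply_nonneg p f)))
    (fun i f g => by rw [map_add]; exact quotientNorm_add_le (he i.1) hl _ _)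
    (fun i c f hc => by rw [map_smul]; exact quotientNorm_smul (he i.1) hl hc _)
    (fun i c => (isClosed_quotientNorm_le (he i.1) hl c).preimage (ι_cont i.2))
    (Equiv.prodCongr (Equiv.refl ℕ) Equiv.boolNot)
    (by
      rintro ⟨m, _ | _⟩ f
      · change quotientNorm ev (e m) f = quotientNorm ev (e m) (-(-f))
        rw [neg_neg]
      · rfl)
    (fun i => rfl)
  refine ⟨A, hA, fun x y a hxy hax => ?_⟩
  choose L hL hLq using fun m f => exists_quotientNorm_eq (he m) hl f
  have defect : ∀ m f g j, (L m f (e m j) - L m g (e m j)) ^ 2 ≤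
      (((1 / 2 : ℝ) ^ m) ^ 2)⁻¹ * (2 * A f ^ 2 + 2 * A g ^ 2 - A (f + g) ^ 2) := by
    intro m f g j
    rw [inv_mul_eq_div, le_div_iff₀ (by positivity), mul_comm]
    exact (mul_le_mul_of_nonneg_left (quotientNorm_defect (he m) hl (hL m f) (hL m g) (hLq m f)
      (hLq m g) j) (by positivity)).trans (hdef (m, true) f g)
  have lim_e : ∀ m j, Tendsto (fun n => L m (y n) (e m j)) atTop (𝓝 (L m a (e m j))) := by
    intro m j
    -- The optimal lifts of `x n` link those of `a` to those of `y n`, one defect for each link.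
    have hx : Tendsto (fun n => L m (x n) (e m j)) atTop (𝓝 (L m a (e m j))) :=
      tendsto_of_sub_sq_le tendsto_const_nhds (by simpa using hax.const_mul _)
        fun n => defect m a (x n) j
    exact tendsto_of_sub_sq_le hx (by simpa using hxy.const_mul _)
      fun n => defect m (x n) (y n) j
  have lim_one : ∀ m, Tendsto (fun n => L m (y n) 1) atTop (𝓝 (L m a 1)) := fun m =>
    lim_e m none
  have lim_φ : ∀ m k s, Tendsto (fun n => L m (y n) (φ k s)) atTop (𝓝 (L m a (φ k s))) := by
    intro m k s
    have hc : ((1 / 2 : ℝ) ^ m * (1 / 2) ^ k) ≠ 0 := by positivity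
    have h3 : ∀ f, L m f (e m (some (k, s))) = ((1 / 2 : ℝ) ^ m * (1 / 2) ^ k) * L m f (φ k s) :=
      fun f => map_smul (L m f) _ _
    have := (lim_e m (some (k, s))).const_mul ((1 / 2 : ℝ) ^ m * (1 / 2) ^ k)⁻¹
    simpa only [h3, inv_mul_cancel_left₀ hc] using this
  refine tendsto_iff_forall_eval_tendsto_topDualPairing.2 fun v => ?_
  change Tendsto (fun n => y n v) atTop (𝓝 (a v))
  have pa : 0 ≤ p a := apply_nonneg p a
  have ng : 0 ≤ ‖ev v‖ := norm_nonneg _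
  rw [← tendsto_sub_nhds_zero_iff, Metric.tendsto_nhds]
  intro δ hδ
  set ε := δ / (4 * (3 * p a + ‖ev v‖ + 1)) with hεdef
  have hε : 0 < ε := by positivity
  obtain ⟨m, k, F, c, hu, hF⟩ := exists_tight_optimal_lift hp hev h0 h1 h2
    (fun m => hL m a) (fun m => hLq m a) (ev v) hε
  have mass : L m a 1 ≤ 3 * p a :=
    ((he m).mass_le_l2 (hL m a).1).trans ((hLq m a).le.trans
      ((quotientNorm_le_mul (he m) (by positivity) hl a).trans
        (mul_le_mul_of_nonneg_right (hK m) pa)))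
  let S : WeakDual ℝ (weakStarUnitSphere p →ᵇ ℝ) → ℝ := fun α => ∑ s ∈ F, c s * α (φ k s)
  let err : WeakDual ℝ (weakStarUnitSphere p →ᵇ ℝ) → ℝ := fun α =>
    ‖ev v‖ * α (1 - ∑ s ∈ F, φ k s) + ε * α 1
  have approx : ∀ f, |f v - S (L m f)| ≤ err (L m f) := fun f => by
    have := abs_sub_sum_le (h0 k) (h1 k F) hε.le hF (hL m f).1
    rwa [(hL m f).2] at this
  have S_lim : Tendsto (fun n => S (L m (y n))) atTop (𝓝 (S (L m a))) :=
    tendsto_finsetSum _ fun s _ => (lim_φ m k s).const_mul _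
  -- Tightness is known only at `a`; convergence of the error passes it to `y n` for large `n`.
  have err_lim : Tendsto (fun n => err (L m (y n))) atTop (𝓝 (err (L m a))) := by
    simp only [err, map_sub, map_sum]
    exact (((lim_one m).sub (tendsto_finsetSum _ fun s _ => lim_φ m k s)).const_mul _).add
      ((lim_one m).const_mul _)
  have err_a : err (L m a) ≤ δ / 4 := by
    have h3 : err (L m a) ≤ ‖ev v‖ * ε + ε * (3 * p a) :=
      add_le_add (mul_le_mul_of_nonneg_left hu ng) (mul_le_mul_of_nonneg_left mass hε.le)
    have h4 : ε * (4 * (3 * p a + ‖ev v‖ + 1)) = δ := div_mul_cancel₀ _ (by positivity)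
    nlinarith
  have h5 : Tendsto (fun n => err (L m (y n)) + |S (L m (y n)) - S (L m a)| + err (L m a)) atTop
      (𝓝 (err (L m a) + |S (L m a) - S (L m a)| + err (L m a))) :=
    (err_lim.add (S_lim.sub tendsto_const_nhds).abs).add tendsto_const_nhds
  have h6 : err (L m a) + |S (L m a) - S (L m a)| + err (L m a) < δ := by
    rw [sub_self, abs_zero]
    linarith
  filter_upwards [h5.eventually (gt_mem_nhds h6)] with n hn
  rw [dist_zero_right, Real.norm_eq_abs]
  refine lt_of_le_of_lt ?_ hn
  have h7 := approx (y n)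
  have h8 := approx a
  rw [abs_sub_comm] at h8
  have h9 : y n v - a v = (y n v - S (L m (y n))) + (S (L m (y n)) - S (L m a)) +
      (S (L m a) - a v) := by ring
  rw [h9]
  exact (abs_add_three _ _ _).trans (add_le_add_three h7 le_rfl h8)

end Renorming

theorem mainTheorem6 {X : Type*} [NormedAddCommGroup X] [NormedSpace ℝ X] :
    (∃ p : Seminorm ℝ (StrongDual ℝ X), IsEquivalentDualNorm p ∧
      ∀ (x y : ℕ → StrongDual ℝ X) (a : StrongDual ℝ X),
        Tendsto (fun n => 2 * p (x n) ^ 2 + 2 * p (y n) ^ 2 - p (x n + y n) ^ 2) atTop (𝓝 0) →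
        Tendsto (fun n => 2 * p a ^ 2 + 2 * p (x n) ^ 2 - p (a + x n) ^ 2) atTop (𝓝 0) →
        Tendsto (fun n => StrongDual.toWeakDual (y n)) atTop (𝓝 (StrongDual.toWeakDual a))) ↔
    (∃ p : Seminorm ℝ (StrongDual ℝ X), IsEquivalentDualNorm p ∧
      TopologicalSpace.MetrizableSpace (weakStarUnitSphere p)) := by
  constructor
  · rintro ⟨p, hp, h⟩
    exact ⟨p, hp, metrizableSpace_weakStarUnitSphere hp h⟩
  · rintro ⟨p, hp, h⟩
    exact exists_dualNorm_of_metrizableSpace_sphere hp
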